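/- Let $T$ be a compact Hausdorff space (for instance a compact metric space), let $t\mapsto a_t\in\mathbb{R}^n$ and $t\mapsto \overline b_t\in\mathbb{R}$ be continuous on $T$, and let $\mathbb{R}^n$ carry an arbitrary norm and $C(T,\mathbb{R})$ the supremum norm. For $b\in C(T,\mathbb{R})$ put $$\mathcal F(b):=\{x\in\mathbb{R}^n \mid a_t'x\le b_t \text{ for all } t\in T\},\qquad f_b(x):=\sup_{t\in T}(a_t'x-b_t),$$ where $u'x$ is the usual inner product. For $x\in\mathcal F(\overline b)$ let $T(x):=\{t\in T\mid a_t'x=\overline b_t\}$, and let $A(x)$ be the convex cone (always containing $0$) generated by $\{a_t\mid t\in T(x)\}$. Write $S^\circ:=\{u\in\mathbb{R}^n\mid u'x\le 0 \text{ for all } x\in S\}$, let $\partial f$ denote the subdifferential of convex analysis, and for $C\subset\mathbb{R}^n$ let $$\operatorname{end} C:=\{u\in\operatorname{cl}C \mid \text{there is no } \mu>1 \text{ with } \mu u\in\operatorname{cl} C\}.$$ The regularity condition at $\overline x\in\mathcal F(\overline b)$ says that there is a neighborhood $W$ of $\overline x$ with $\mathcal F(\overline b)\cap W=(\overline x+A(\overline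 x)^\circ)\cap W$. The calmness modulus $\operatorname{clm}\mathcal F(\overline b,\overline x)\in[0,+\infty]$ is the infimum ($+\infty$ if there are none) of the constants $\kappa\ge 0$ for which there is a neighborhood $U$ of $\overline x$ with $d(x,\mathcal F(\overline b))\le\kappa\, d(\overline b,\mathcal F^{-1}(x))$ for all $x\in U$, where $\mathcal F^{-1}(x)=\{b\in C(T,\mathbb{R})\mid x\in\mathcal F(b)\}$. Let $x^1,x^2$ be boundary points of $\mathcal F(\overline b)$ such that $T(x^1)\subseteq T(x^2)$. Then: (i) $\operatorname{end}\partial f_{\overline b}(x^1)\subseteq\operatorname{end}\partial f_{\overline b}(x^2)$; (ii) if the regularity condition holds at both $x^1$ and $x^2$, then $\operatorname{clm}\mathcal F(\overline b,x^1)\le\operatorname{clm}\mathcal F(\overline b,x^2)$. -/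

import Mathlib

open Set Filter Topology
open scoped NNReal ENNReal Matrix

noncomputable section

/-- A norm on `ℝⁿ`, not tied to the one that Mathlib puts on `Fin n → ℝ`. -/
structure VecNorm (n : ℕ) extends Seminorm ℝ (Fin n → ℝ) where
  eq_zero_of_apply_eq_zero : ∀ x : Fin n → ℝ, toFun x = 0 → x = 0

/-- `ℝⁿ` equipped with the norm `N`. -/
structure NormedRn (n : ℕ) (N : VecNorm n) where
  /-- The point with the given coordinates. -/
  mk ::
  /-- The coordinates of a point. -/
  coords : Fin n → ℝ

namespace NormedRn

variable {n : ℕ} {N : VecNorm n}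

/-- A point is determined by its coordinates. -/
def equivCoords : NormedRn n N ≃ (Fin n → ℝ) where
  toFun := coords
  invFun := mk
  left_inv _ := rfl
  right_inv _ := rfl

instance : AddCommGroup (NormedRn n N) := equivCoords.addCommGroup

instance : Module ℝ (NormedRn n N) := equivCoords.module ℝ

instance : Norm (NormedRn n N) := ⟨fun x => N.toSeminorm x.coords⟩

theorem coords_add (x y : NormedRn n N) : (x + y).coords = x.coords + y.coords := rfl

theorem coords_zero : (0 : NormedRn n N).coords = 0 := rfl

theorem coords_sub (x y : NormedRn n N) : (x - y).coords = x.coords - y.coords := rfl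

theorem coords_smul (c : ℝ) (x : NormedRn n N) : (c • x).coords = c • x.coords := rfl

theorem normedSpaceCore : NormedSpace.Core ℝ (NormedRn n N) where
  norm_nonneg x := apply_nonneg N.toSeminorm x.coords
  norm_smul c x := map_smul_eq_mul N.toSeminorm c x.coords
  norm_triangle x y := map_add_le_add N.toSeminorm x.coords y.coords
  norm_eq_zero_iff x := by
    constructor
    · intro h
      exact equivCoords.injective (N.eq_zero_of_apply_eq_zero x.coords h)
    · rintro rfl
      exact map_zero N.toSeminorm

instance : NormedAddCommGroup (NormedRn n N) := NormedAddCommGroup.ofCore normedSpaceCore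

instance : NormedSpace ℝ (NormedRn n N) := NormedSpace.ofCore normedSpaceCore

end NormedRn

/-- The inverse of a multifunction. -/
def multiInverse {Y X : Type*} (M : Y → Set X) (x : X) : Set Y :=
  {y | x ∈ M y}

/-- The calmness modulus of the multifunction `M` at `(y₀, x₀)`: the infimum, `∞` if there are none,
of the constants `κ ≥ 0` such that `d(x, M y₀) ≤ κ d(y₀, M⁻¹ x)` for all `x` near `x₀`. -/
def calmnessModulus {Y X : Type*} [MetricSpace Y] [MetricSpace X] (M : Y → Set X)
    (y₀ : Y) (x₀ : X) : ℝ≥0∞ :=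
  ⨅ (κ : ℝ≥0) (_ : ∃ U ∈ 𝓝 x₀, ∀ x ∈ U,
    Metric.infEDist x (M y₀) ≤ (κ : ℝ≥0∞) * Metric.infEDist y₀ (multiInverse M x)), (κ : ℝ≥0∞)

/-- The end set of `C`. -/
def endSet {n : ℕ} (C : Set (Fin n → ℝ)) : Set (Fin n → ℝ) :=
  {u | u ∈ closure C ∧ ¬ ∃ μ : ℝ, 1 < μ ∧ μ • u ∈ closure C}

/-- The (negative) polar of `S`. -/
def negPolar {n : ℕ} (S : Set (Fin n → ℝ)) : Set (Fin n → ℝ) :=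
  {u | ∀ x ∈ S, u ⬝ᵥ x ≤ 0}

/-- The subdifferential at `x` of a function on `ℝⁿ`. -/
def subdiff {n : ℕ} {N : VecNorm n} (f : NormedRn n N → ℝ) (x : NormedRn n N) :
    Set (Fin n → ℝ) :=
  {u | ∀ y : NormedRn n N, f x + u ⬝ᵥ (y.coords - x.coords) ≤ f y}

section LinearSystem

variable {n : ℕ} (N : VecNorm n) {T : Type*} [TopologicalSpace T] [CompactSpace T]

/-- The feasible set of the system `aₜ' x ≤ bₜ`, `t ∈ T`. -/
def feasibleSet (a : C(T, Fin n → ℝ)) (b : C(T, ℝ)) : Set (NormedRn n N) :=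
  {x | ∀ t, a t ⬝ᵥ x.coords ≤ b t}

/-- The supremum function `f_b` of the system. -/
def supFun (a : C(T, Fin n → ℝ)) (b : C(T, ℝ)) (x : NormedRn n N) : ℝ :=
  ⨆ t, (a t ⬝ᵥ x.coords - b t)

variable {N}

/-- The set of active indices at `x`. -/
def activeIndices (a : C(T, Fin n → ℝ)) (b : C(T, ℝ)) (x : NormedRn n N) : Set T :=
  {t | a t ⬝ᵥ x.coords - b t = 0}

/-- The active cone at `x`: the convex cone, always containing `0`, generated by the active `aₜ`. -/
def activeCone (a : C(T, Fin n → ℝ)) (b : C(T, ℝ)) (x : NormedRn n N) :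
    PointedCone ℝ (Fin n → ℝ) :=
  PointedCone.hull ℝ (a '' activeIndices a b x)

/-- The regularity condition at `x₀`: near `x₀`, the feasible set is `x₀` plus the polar of the
active cone. -/
def RegularAt (a : C(T, Fin n → ℝ)) (b : C(T, ℝ)) (x₀ : NormedRn n N) : Prop :=
  ∃ W ∈ 𝓝 x₀, feasibleSet N a b ∩ W =
    {x : NormedRn n N | x.coords - x₀.coords ∈
      negPolar (activeCone a b x₀ : Set (Fin n → ℝ))} ∩ W

end LinearSystem

end

/-!
At a boundary point `f_b` vanishes, and its directional derivative along `d` is the maximum of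
`aₜ' d` over the active `t`. For `u ∈ ∂f_b(x₁)`, the subgradient inequality at `x₂` gives
`u' (x₂ - x₁) ≤ 0`, while along `x₁ - x₂` all constraints active at `x₁` stay active, which gives
the opposite inequality. Hence `u' x₁ = u' x₂`, a condition under which membership in `∂f_b(x₁)` and
in `∂f_b(x₂)` is the same, also for the multiples of `u`.

For the calmness moduli, `d(b, F⁻¹ x)` is the positive part of `f_b x`, so that calmness is a local
error bound for `f_b`. Blowing up at a feasible point turns it into a global error bound, with the
same constant, of the homogeneous system formed by the active constraints, and under regularity the
latter implies the former. A calmness constant at `x₂` is one at all points near `x₂`; those on the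
open segment from `x₁` to `x₂` have the active indices of `x₁`, hence the same homogeneous system.
-/

namespace NormedRn

variable {n : ℕ} {N : VecNorm n}

/-- The identification of `ℝⁿ` normed by `N` with `ℝⁿ`, as a linear equivalence: it transfers
finite-dimensionality, and hence continuity of linear maps, to `NormedRn n N`. -/
def coordsLinearEquiv (N : VecNorm n) : NormedRn n N ≃ₗ[ℝ] (Fin n → ℝ) where
  __ := equivCoords
  map_add' := coords_add
  map_smul' := coords_smul

instance : FiniteDimensional ℝ (NormedRn n N) :=
  (coordsLinearEquiv N).symm.finiteDimensional

@[fun_prop]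
theorem continuous_coords : Continuous (coords : NormedRn n N → Fin n → ℝ) :=
  (coordsLinearEquiv N).toLinearMap.continuous_of_finiteDimensional

end NormedRn

section Calmness

variable {X Y : Type*}

theorem eventually_infEDist_le_infEDist_of_inter_subset [PseudoEMetricSpace X] {x₀ : X}
    {F G W : Set X} (hx₀ : x₀ ∈ F) (hW : W ∈ 𝓝 x₀) (hGF : G ∩ W ⊆ F) :
    ∀ᶠ x in 𝓝 x₀, Metric.infEDist x F ≤ Metric.infEDist x G := by
  obtain ⟨R, hR, hRW⟩ := EMetric.mem_nhds_iff.1 hW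
  filter_upwards [Metric.eball_mem_nhds x₀ (ENNReal.half_pos hR.ne')] with x hx
  refine Metric.le_infEDist.2 fun z hz => ?_
  rcases le_total (edist x x₀) (edist x z) with h | h
  · exact (Metric.infEDist_le_edist_of_mem hx₀).trans h
  · refine Metric.infEDist_le_edist_of_mem (hGF ⟨hz, hRW ?_⟩)
    calc edist z x₀ ≤ edist x z + edist x x₀ := edist_triangle_left z x₀ x
      _ < R / 2 + R / 2 := ENNReal.add_lt_add (h.trans_lt hx) hx
      _ = R := ENNReal.add_halves R

/-- `κ` is a calmness constant of the multifunction `M` at `(y₀, x₀)`. The calmness modulus is the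
infimum of these constants. -/
def IsCalmnessConstant [PseudoEMetricSpace X] [PseudoEMetricSpace Y] (M : Y → Set X)
    (y₀ : Y) (x₀ : X) (κ : ℝ≥0) : Prop :=
  ∀ᶠ x in 𝓝 x₀, Metric.infEDist x (M y₀) ≤ κ * Metric.infEDist y₀ (multiInverse M x)

theorem IsCalmnessConstant.exists_mem_openSegment [SeminormedAddCommGroup X] [NormedSpace ℝ X]
    [PseudoEMetricSpace Y] {M : Y → Set X} {y₀ : Y} {x₂ : X} {κ : ℝ≥0}
    (hκ : IsCalmnessConstant M y₀ x₂ κ) (x₁ : X) :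
    ∃ x ∈ openSegment ℝ x₁ x₂, IsCalmnessConstant M y₀ x κ := by
  have hx₂ : x₂ ∈ closure (openSegment ℝ x₁ x₂) :=
    segment_subset_closure_openSegment (right_mem_segment ℝ x₁ x₂)
  exact ((mem_closure_iff_frequently.1 hx₂).and_eventually hκ.eventually_nhds).exists

theorem calmnessModulus_le_calmnessModulus [MetricSpace X] [MetricSpace Y] {M : Y → Set X}
    {y₁ y₂ : Y} {x₁ x₂ : X}
    (h : ∀ κ, IsCalmnessConstant M y₂ x₂ κ → IsCalmnessConstant M y₁ x₁ κ) :
    calmnessModulus M y₁ x₁ ≤ calmnessModulus M y₂ x₂ :=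
  le_iInf₂ fun κ hκ => iInf₂_le κ <|
    eventually_iff_exists_mem.1 <| h κ <| eventually_iff_exists_mem.2 hκ

end Calmness

section Polar

variable {n : ℕ}

theorem negPolar_hull (S : Set (Fin n → ℝ)) :
    negPolar (PointedCone.hull ℝ S : Set (Fin n → ℝ)) = negPolar S := by
  refine Subset.antisymm (fun u hu v hv => hu v (Submodule.subset_span hv)) fun u hu v hv => ?_
  induction hv using Submodule.span_induction with
  | mem v hv => exact hu v hv
  | zero => simp
  | add v w _ _ hv hw => rw [dotProduct_add]; exact add_nonpos hv hw
  | smul c v _ hv => rw [dotProduct_smul]; exact smul_nonpos_of_nonneg_of_nonpos c.2 hv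

/-- `κ` is a Hoffman constant (a global error bound) of the homogeneous system `v' d ≤ 0`, `v ∈ S`:
the distance from `d` to its solution set is at most `κ` times any bound `c ≥ 0` of the
residuals. -/
def IsHoffmanConstant (N : VecNorm n) (S : Set (Fin n → ℝ)) (κ : ℝ≥0) : Prop :=
  ∀ (d : NormedRn n N) (c : ℝ≥0), (∀ v ∈ S, v ⬝ᵥ d.coords ≤ c) →
    Metric.infEDist d (NormedRn.coords ⁻¹' negPolar S) ≤ κ * c

end Polar

section Subdifferential

variable {n : ℕ} {N : VecNorm n} {f : NormedRn n N → ℝ} {x y : NormedRn n N}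

theorem isClosed_subdiff : IsClosed (subdiff f x) := by
  simp only [subdiff, ofPred_forall]
  exact isClosed_iInter fun y => isClosed_le (by fun_prop) continuous_const

theorem mem_subdiff_iff_of_dotProduct_eq {u : Fin n → ℝ} (hf : f x = f y)
    (hu : u ⬝ᵥ x.coords = u ⬝ᵥ y.coords) : u ∈ subdiff f x ↔ u ∈ subdiff f y := by
  simp only [subdiff, mem_ofPred_eq, dotProduct_sub, hf, hu]

theorem endSet_subdiff_subset_of_dotProduct_eq (hf : f x = f y)
    (h : ∀ u ∈ subdiff f x, u ⬝ᵥ x.coords = u ⬝ᵥ y.coords) :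
    endSet (subdiff f x) ⊆ endSet (subdiff f y) := by
  simp only [endSet, isClosed_subdiff.closure_eq]
  rintro u ⟨hu, hend⟩
  refine ⟨(mem_subdiff_iff_of_dotProduct_eq hf (h u hu)).1 hu, fun ⟨μ, hμ, hμu⟩ => ?_⟩
  refine hend ⟨μ, hμ, (mem_subdiff_iff_of_dotProduct_eq hf ?_).2 hμu⟩
  rw [smul_dotProduct, smul_dotProduct, h u hu]

end Subdifferential

section FeasibleSet

variable {n : ℕ} {N : VecNorm n} {T : Type*} [TopologicalSpace T]
  {a : C(T, Fin n → ℝ)} {b : C(T, ℝ)} {x x₁ x₂ y : NormedRn n N}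

theorem isClosed_feasibleSet : IsClosed (feasibleSet N a b) := by
  simp only [feasibleSet, ofPred_forall]
  exact isClosed_iInter fun t => isClosed_le (by fun_prop) continuous_const

theorem mem_feasibleSet_of_mem_frontier (hx : x ∈ frontier (feasibleSet N a b)) :
    x ∈ feasibleSet N a b :=
  isClosed_feasibleSet.frontier_subset hx

theorem convex_feasibleSet : Convex ℝ (feasibleSet N a b) := by
  intro x hx y hy α β hα hβ hαβ t
  rw [NormedRn.coords_add, NormedRn.coords_smul, NormedRn.coords_smul, dotProduct_add,
    dotProduct_smul, dotProduct_smul]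
  exact convex_Iic (b t) (hx t) (hy t) hα hβ hαβ

theorem activeIndices_eq_inter_of_mem_openSegment (hx₁ : x₁ ∈ feasibleSet N a b)
    (hx₂ : x₂ ∈ feasibleSet N a b) (hy : y ∈ openSegment ℝ x₁ x₂) :
    activeIndices a b y = activeIndices a b x₁ ∩ activeIndices a b x₂ := by
  obtain ⟨α, β, hα, hβ, hαβ, rfl⟩ := hy
  ext t
  have hcombo : a t ⬝ᵥ (α • x₁ + β • x₂).coords - b t =
      α * (a t ⬝ᵥ x₁.coords - b t) + β * (a t ⬝ᵥ x₂.coords - b t) := by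
    rw [NormedRn.coords_add, NormedRn.coords_smul, NormedRn.coords_smul, dotProduct_add,
      dotProduct_smul, dotProduct_smul, smul_eq_mul, smul_eq_mul]
    linear_combination b t * hαβ
  have h₁ : α * (a t ⬝ᵥ x₁.coords - b t) ≤ 0 :=
    mul_nonpos_of_nonneg_of_nonpos hα.le (sub_nonpos.2 (hx₁ t))
  have h₂ : β * (a t ⬝ᵥ x₂.coords - b t) ≤ 0 :=
    mul_nonpos_of_nonneg_of_nonpos hβ.le (sub_nonpos.2 (hx₂ t))
  have hzero : α * (a t ⬝ᵥ x₁.coords - b t) + β * (a t ⬝ᵥ x₂.coords - b t) = 0 ↔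
      α * (a t ⬝ᵥ x₁.coords - b t) = 0 ∧ β * (a t ⬝ᵥ x₂.coords - b t) = 0 := by
    exact ⟨fun h => ⟨by linarith, by linarith⟩, fun h => by rw [h.1, h.2, add_zero]⟩
  simp only [activeIndices, mem_inter_iff, mem_ofPred_eq, hcombo, hzero, mul_eq_zero, hα.ne',
    hβ.ne', false_or]

theorem negPolar_activeCone :
    negPolar (activeCone a b x : Set (Fin n → ℝ)) = negPolar (a '' activeIndices a b x) :=
  negPolar_hull _

theorem coords_sub_mem_negPolar_of_mem_feasibleSet (hy : y ∈ feasibleSet N a b) :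
    y.coords - x.coords ∈ negPolar (a '' activeIndices a b x) := by
  rintro _ ⟨t, ht, rfl⟩
  have hactive : a t ⬝ᵥ x.coords - b t = 0 := ht
  rw [dotProduct_comm, dotProduct_sub]
  linarith [hy t]

theorem RegularAt.mem_feasibleSet (hreg : RegularAt a b x) : x ∈ feasibleSet N a b := by
  obtain ⟨W, hW, hWeq⟩ := hreg
  refine (hWeq.ge ⟨?_, mem_of_mem_nhds hW⟩).1
  simp [negPolar]

theorem RegularAt.eventually_infEDist_le (hreg : RegularAt a b x) :
    ∀ᶠ y in 𝓝 x, Metric.infEDist y (feasibleSet N a b) ≤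
      Metric.infEDist (y - x) (NormedRn.coords ⁻¹' negPolar (a '' activeIndices a b x)) := by
  have hx := hreg.mem_feasibleSet
  obtain ⟨W, hW, hWeq⟩ := hreg
  filter_upwards [eventually_infEDist_le_infEDist_of_inter_subset hx hW
    (hWeq.ge.trans inter_subset_left)] with y hy
  refine Metric.le_infEDist.2 fun w hw => hy.trans ?_
  have hxw : x + w ∈ {z : NormedRn n N | z.coords - x.coords ∈
      negPolar (activeCone a b x : Set (Fin n → ℝ))} := by
    rw [mem_ofPred_eq, NormedRn.coords_add, add_sub_cancel_left, negPolar_activeCone]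
    exact hw
  calc _ ≤ edist y (x + w) := Metric.infEDist_le_edist_of_mem hxw
    _ = edist (y - x) w := by rw [← edist_add_left x (y - x) w, add_sub_cancel]

theorem mul_infEDist_negPolar_le {r : ℝ} (hr : 0 < r) (d : NormedRn n N) :
    ENNReal.ofReal r * Metric.infEDist d (NormedRn.coords ⁻¹' negPolar (a '' activeIndices a b x)) ≤
      Metric.infEDist (x + r • d) (feasibleSet N a b) := by
  refine Metric.le_infEDist.2 fun z hz => ?_
  set w := r⁻¹ • (z - x) with hw
  have hwP : w.coords ∈ negPolar (a '' activeIndices a b x) := fun v hv => by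
    rw [hw, NormedRn.coords_smul, NormedRn.coords_sub, smul_dotProduct]
    exact smul_nonpos_of_nonneg_of_nonpos (by positivity)
      (coords_sub_mem_negPolar_of_mem_feasibleSet hz v hv)
  have hzw : z = x + r • w := by rw [hw, smul_inv_smul₀ hr.ne', add_sub_cancel]
  rw [hzw, edist_add_left, edist_smul₀, ENNReal.smul_def, smul_eq_mul,
    Real.nnnorm_of_nonneg hr.le, ENNReal.ofReal_eq_coe_nnreal hr.le]
  gcongr
  exact Metric.infEDist_le_edist_of_mem hwP

end FeasibleSet

theorem eventually_forall_add_mul_nonpos {T : Type*} [TopologicalSpace T] [CompactSpace T]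
    {σ γ : T → ℝ} (hσ : Continuous σ) (hγ : Continuous γ) (hσ_nonpos : ∀ t, σ t ≤ 0)
    (hγ_neg : ∀ t, σ t = 0 → γ t < 0) :
    ∀ᶠ r : ℝ in 𝓝[>] 0, ∀ t, σ t + r * γ t ≤ 0 := by
  have hlocal : ∀ᶠ r : ℝ in 𝓝 0, ∀ t ∈ (univ : Set T), 0 < r → σ t + r * γ t ≤ 0 := by
    refine isCompact_univ.eventually_forall_of_forall_eventually fun t _ => ?_
    rcases (hσ_nonpos t).lt_or_eq with hneg | hzero
    · have hcont : Continuous fun p : ℝ × T => σ p.2 + p.1 * γ p.2 := by fun_prop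
      filter_upwards [hcont.continuousAt.eventually_lt_const (by simpa using hneg)] with p hp _
      exact hp.le
    · have hcont : Continuous fun p : ℝ × T => γ p.2 := by fun_prop
      filter_upwards [hcont.continuousAt.eventually_lt_const (hγ_neg t hzero)] with p hp hr
      exact add_nonpos (hσ_nonpos p.2) (mul_nonpos_of_nonneg_of_nonpos hr.le hp.le)
  filter_upwards [nhdsWithin_le_nhds hlocal, self_mem_nhdsWithin] with r hr hr0 t
  exact hr t (mem_univ t) hr0

section SupFun

variable {n : ℕ} {N : VecNorm n} {T : Type*} [TopologicalSpace T] [CompactSpace T]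
  {a : C(T, Fin n → ℝ)} {b : C(T, ℝ)} {x x₁ x₂ : NormedRn n N}

theorem le_supFun (x : NormedRn n N) (t : T) : a t ⬝ᵥ x.coords - b t ≤ supFun N a b x :=
  le_ciSup (f := fun t => a t ⬝ᵥ x.coords - b t)
    (isCompact_range (by fun_prop)).bddAbove t

theorem supFun_eq_zero (hx : x ∈ feasibleSet N a b) (hne : (activeIndices a b x).Nonempty) :
    supFun N a b x = 0 := by
  obtain ⟨t, ht⟩ := hne
  exact le_antisymm (Real.iSup_nonpos fun s => sub_nonpos.2 (hx s)) (ht.ge.trans (le_supFun x t))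

theorem activeIndices_nonempty_of_mem_frontier (hx : x ∈ frontier (feasibleSet N a b)) :
    (activeIndices a b x).Nonempty := by
  by_contra hempty
  have hslack : ∀ t, a t ⬝ᵥ x.coords - b t < 0 := fun t =>
    (sub_nonpos.2 (mem_feasibleSet_of_mem_frontier hx t)).lt_of_ne fun ht => hempty ⟨t, ht⟩
  refine hx.2 (mem_interior_iff_mem_nhds.2 ?_)
  have hcont : Continuous fun p : NormedRn n N × T => a p.2 ⬝ᵥ p.1.coords - b p.2 := by fun_prop
  have hnear : ∀ᶠ y in 𝓝 x, ∀ t ∈ (univ : Set T), a t ⬝ᵥ y.coords - b t < 0 :=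
    isCompact_univ.eventually_forall_of_forall_eventually fun t _ =>
      hcont.continuousAt.eventually_lt_const (hslack t)
  filter_upwards [hnear] with y hy t
  exact (sub_neg.1 (hy t (mem_univ t))).le

theorem eventually_forall_slack_le (hx : x ∈ feasibleSet N a b) {d : NormedRn n N} {c : ℝ}
    (hd : ∀ t ∈ activeIndices a b x, a t ⬝ᵥ d.coords < c) :
    ∀ᶠ r : ℝ in 𝓝[>] 0, ∀ t, a t ⬝ᵥ (x + r • d).coords - b t ≤ r * c := by
  filter_upwards [eventually_forall_add_mul_nonpos
    (σ := fun t => a t ⬝ᵥ x.coords - b t) (γ := fun t => a t ⬝ᵥ d.coords - c)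
    (by fun_prop) (by fun_prop) (fun t => sub_nonpos.2 (hx t))
    fun t ht => sub_neg.2 (hd t ht)] with r hr t
  rw [NormedRn.coords_add, NormedRn.coords_smul, dotProduct_add, dotProduct_smul, smul_eq_mul]
  linarith [hr t]

/-- The dual form of the inclusion `∂f(x) ⊆ conv {aₜ | t ∈ T(x)}`. -/
theorem dotProduct_le_of_mem_subdiff (hx : x ∈ feasibleSet N a b)
    (hne : (activeIndices a b x).Nonempty) {u : Fin n → ℝ} (hu : u ∈ subdiff (supFun N a b) x)
    {d : NormedRn n N} {c : ℝ} (hd : ∀ t ∈ activeIndices a b x, a t ⬝ᵥ d.coords ≤ c) :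
    u ⬝ᵥ d.coords ≤ c := by
  have : Nonempty T := hne.to_type
  refine le_of_forall_gt_imp_ge_of_dense fun c' hc' => ?_
  obtain ⟨r, hr, hr0⟩ := ((eventually_forall_slack_le hx fun t ht => (hd t ht).trans_lt hc').and
    self_mem_nhdsWithin).exists
  refine le_of_mul_le_mul_left ?_ (show 0 < r from hr0)
  calc r * (u ⬝ᵥ d.coords) = supFun N a b x + u ⬝ᵥ ((x + r • d).coords - x.coords) := by
        rw [supFun_eq_zero hx hne, zero_add, NormedRn.coords_add, add_sub_cancel_left,
          NormedRn.coords_smul, dotProduct_smul, smul_eq_mul]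
    _ ≤ supFun N a b (x + r • d) := hu _
    _ ≤ r * c' := ciSup_le hr

theorem dotProduct_eq_of_mem_subdiff_of_activeIndices_subset (hx₁ : x₁ ∈ feasibleSet N a b)
    (hx₂ : x₂ ∈ feasibleSet N a b) (hne : (activeIndices a b x₁).Nonempty)
    (hT : activeIndices a b x₁ ⊆ activeIndices a b x₂) {u : Fin n → ℝ}
    (hu : u ∈ subdiff (supFun N a b) x₁) : u ⬝ᵥ x₁.coords = u ⬝ᵥ x₂.coords := by
  have hle : u ⬝ᵥ (x₁ - x₂).coords ≤ 0 := by
    refine dotProduct_le_of_mem_subdiff hx₁ hne hu fun t ht => ?_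
    have h₁ : a t ⬝ᵥ x₁.coords - b t = 0 := ht
    have h₂ : a t ⬝ᵥ x₂.coords - b t = 0 := hT ht
    rw [NormedRn.coords_sub, dotProduct_sub]
    linarith
  have hge := hu x₂
  rw [supFun_eq_zero hx₁ hne, supFun_eq_zero hx₂ (hne.mono hT), dotProduct_sub] at hge
  rw [NormedRn.coords_sub, dotProduct_sub] at hle
  linarith

theorem infEDist_multiInverse_feasibleSet (b : C(T, ℝ)) (x : NormedRn n N) :
    Metric.infEDist b (multiInverse (feasibleSet N a) x) = ENNReal.ofReal (supFun N a b x) := by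
  apply le_antisymm
  · set c : ℝ≥0 := (supFun N a b x).toNNReal with hc
    have hmem : b + ContinuousMap.const T (c : ℝ) ∈ multiInverse (feasibleSet N a) x := fun t =>
      sub_le_iff_le_add'.1 ((le_supFun x t).trans (Real.le_coe_toNNReal _))
    calc _ ≤ edist b (b + ContinuousMap.const T (c : ℝ)) := Metric.infEDist_le_edist_of_mem hmem
      _ ≤ ENNReal.ofReal c := by
        rw [edist_dist]
        refine ENNReal.ofReal_le_ofReal ((ContinuousMap.dist_le c.2).2 fun t => ?_)
        simp
      _ = ENNReal.ofReal (supFun N a b x) := by rw [ENNReal.ofReal_coe_nnreal, hc]; rfl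
  · refine Metric.le_infEDist.2 fun b' hb' => ?_
    rw [edist_dist]
    refine ENNReal.ofReal_le_ofReal (Real.iSup_le (fun t => ?_) dist_nonneg)
    calc a t ⬝ᵥ x.coords - b t ≤ b' t - b t := sub_le_sub_right (hb' t) _
      _ ≤ dist (b t) (b' t) := by rw [dist_comm]; exact le_abs_self _
      _ ≤ dist b b' := ContinuousMap.dist_apply_le_dist t

theorem IsCalmnessConstant.isHoffmanConstant {κ : ℝ≥0}
    (hκ : IsCalmnessConstant (feasibleSet N a) b x κ) (hx : x ∈ feasibleSet N a b) :
    IsHoffmanConstant N (a '' activeIndices a b x) κ := by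
  intro d c hd
  have hray : Tendsto (fun r : ℝ => x + r • d) (𝓝[>] 0) (𝓝 x) :=
    (Continuous.tendsto' (by fun_prop) 0 x (by simp)).mono_left nhdsWithin_le_nhds
  have hbound : ∀ c' : ℝ≥0, c < c' → Metric.infEDist d
      (NormedRn.coords ⁻¹' negPolar (a '' activeIndices a b x)) ≤ (κ : ℝ≥0∞) * c' := by
    intro c' hc'
    obtain ⟨r, ⟨hslack, hcalm⟩, hr0⟩ := (((eventually_forall_slack_le hx fun t ht =>
      (hd _ (mem_image_of_mem a ht)).trans_lt hc').and (hray.eventually hκ)).and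
      self_mem_nhdsWithin).exists
    have hr : 0 < r := hr0
    rw [← ENNReal.mul_le_mul_iff_right (ENNReal.ofReal_pos.2 hr).ne' ENNReal.ofReal_ne_top]
    calc _ ≤ Metric.infEDist (x + r • d) (feasibleSet N a b) := mul_infEDist_negPolar_le hr d
      _ ≤ κ * ENNReal.ofReal (supFun N a b (x + r • d)) := by
        rwa [infEDist_multiInverse_feasibleSet] at hcalm
      _ ≤ κ * ENNReal.ofReal (r * c') := by
        gcongr
        exact Real.iSup_le hslack (by positivity)
      _ = ENNReal.ofReal r * (κ * c') := by
        rw [ENNReal.ofReal_mul hr.le, ENNReal.ofReal_coe_nnreal, mul_left_comm]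
  have hlim : Tendsto (fun c' : ℝ≥0 => (κ : ℝ≥0∞) * c') (𝓝[>] c) (𝓝 (κ * c)) :=
    (((ENNReal.continuous_const_mul ENNReal.coe_ne_top).comp
      ENNReal.continuous_coe).tendsto c).mono_left nhdsWithin_le_nhds
  exact ge_of_tendsto hlim (eventually_mem_nhdsWithin.mono hbound)

theorem IsHoffmanConstant.isCalmnessConstant {κ : ℝ≥0}
    (hκ : IsHoffmanConstant N (a '' activeIndices a b x) κ) (hreg : RegularAt a b x) :
    IsCalmnessConstant (feasibleSet N a) b x κ := by
  filter_upwards [hreg.eventually_infEDist_le] with y hy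
  rw [infEDist_multiInverse_feasibleSet]
  refine hy.trans (hκ (y - x) (supFun N a b y).toNNReal ?_)
  rintro _ ⟨t, ht, rfl⟩
  have hactive : a t ⬝ᵥ x.coords - b t = 0 := ht
  calc a t ⬝ᵥ (y - x).coords = a t ⬝ᵥ y.coords - b t := by
        rw [NormedRn.coords_sub, dotProduct_sub]
        linarith
    _ ≤ supFun N a b y := le_supFun y t
    _ ≤ _ := Real.le_coe_toNNReal _

theorem IsCalmnessConstant.of_activeIndices_subset {κ : ℝ≥0}
    (hκ : IsCalmnessConstant (feasibleSet N a) b x₂ κ) (hx₂ : x₂ ∈ feasibleSet N a b)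
    (hT : activeIndices a b x₁ ⊆ activeIndices a b x₂) (hreg : RegularAt a b x₁) :
    IsCalmnessConstant (feasibleSet N a) b x₁ κ := by
  have hx₁ := hreg.mem_feasibleSet
  obtain ⟨y, hy, hκy⟩ := hκ.exists_mem_openSegment x₁
  have hactive : activeIndices a b y = activeIndices a b x₁ := by
    rw [activeIndices_eq_inter_of_mem_openSegment hx₁ hx₂ hy, inter_eq_left.2 hT]
  have hoffman := hκy.isHoffmanConstant (convex_feasibleSet.openSegment_subset hx₁ hx₂ hy)
  rw [hactive] at hoffman
  exact hoffman.isCalmnessConstant hreg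

theorem mainTheorem6_general (hx₁ : x₁ ∈ feasibleSet N a b) (hx₂ : x₂ ∈ feasibleSet N a b)
    (hne : (activeIndices a b x₁).Nonempty)
    (hT : activeIndices a b x₁ ⊆ activeIndices a b x₂) :
    endSet (subdiff (supFun N a b) x₁) ⊆ endSet (subdiff (supFun N a b) x₂) ∧
      (RegularAt a b x₁ →
        calmnessModulus (feasibleSet N a) b x₁ ≤ calmnessModulus (feasibleSet N a) b x₂) := by
  refine ⟨endSet_subdiff_subset_of_dotProduct_eq ?_ fun u hu => ?_, fun hreg =>
    calmnessModulus_le_calmnessModulus fun κ hκ => hκ.of_activeIndices_subset hx₂ hT hreg⟩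
  · rw [supFun_eq_zero hx₁ hne, supFun_eq_zero hx₂ (hne.mono hT)]
  · exact dotProduct_eq_of_mem_subdiff_of_activeIndices_subset hx₁ hx₂ hne hT hu

end SupFun

theorem mainTheorem6 {n : ℕ} (N : VecNorm n) {T : Type*} [TopologicalSpace T] [CompactSpace T]
    [T2Space T] (a : C(T, Fin n → ℝ)) (b : C(T, ℝ)) (x₁ x₂ : NormedRn n N)
    (hx₁ : x₁ ∈ frontier (feasibleSet N a b)) (hx₂ : x₂ ∈ frontier (feasibleSet N a b))
    (hT : activeIndices a b x₁ ⊆ activeIndices a b x₂) :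
    endSet (subdiff (supFun N a b) x₁) ⊆ endSet (subdiff (supFun N a b) x₂) ∧
      (RegularAt a b x₁ → RegularAt a b x₂ →
        calmnessModulus (feasibleSet N a) b x₁ ≤ calmnessModulus (feasibleSet N a) b x₂) :=
  have h := mainTheorem6_general (mem_feasibleSet_of_mem_frontier hx₁)
    (mem_feasibleSet_of_mem_frontier hx₂) (activeIndices_nonempty_of_mem_frontier hx₁) hT
  ⟨h.1, fun hreg _ => h.2 hreg⟩
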